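/- Let $X$ be a countable set, $m\colon X\to(0,\infty)$, also viewed as a measure on $X$ via countable additivity, and let $b\colon X\times X\to[0,\infty)$ be a graph over $(X,m)$: $b$ is symmetric, $b(x,x)=0$ and $\sum_{y}b(x,y)<\infty$ for all $x\in X$. Write $x\sim y$ if $b(x,y)>0$. All graphs are assumed to be locally finite (every $x$ has only finitely many $y\sim x$) and connected (any two vertices are joined by a finite path of neighbours). Let $\Delta\ge 0$ be the self-adjoint operator in $\ell^2(X,m)$ obtained as the Friedrichs extension of $$\Delta f(x)=\frac1{m(x)}\sum_{y\in X}b(x,y)(f(x)-f(y)),\qquad f\in C_c(X),$$ where $C_c(X)$ is the space of finitely supported functions, and let $$p_t(x,y)=\frac{1}{m(x)m(y)}\langle\delta_x,e^{-t\Delta}\delta_y\rangle_{\ell^2(X,m)},\qquad x,y\in X,\ t>0,$$ be its heat kernel, where $\delta_x$ is the function equal to one at $x$ and zero elsewhere. A pseudo-metric $\rho\colon X\times X\to[0,\infty)$ is called intrinsic if $\sum_{y}b(x,y)\rho(x,y)^2\le m(x)$ for all $x\in X$; its jump size is $\sup\{\rho(x,y): x\sim y\}$. For $S>0$ put $$\rho_S(x,y)=\sup\{\rho(x,y):\rho\text{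 is intrinsic with jump size at most }S\},$$ which is finite since the graph is connected, and let $\zeta(r)=r\operatorname{arsinh}(r)+1-\sqrt{r^2+1}$ for $r\ge0$. Then, for every such graph and every $S>0$, $$p_t(x,y)\le\frac{1}{\sqrt{m(x)m(y)}}\exp\left(-\frac{t}{S^2}\,\zeta\left(\frac{\rho_S(x,y)S}{t}\right)\right)\qquad\text{for all }x,y\in X,\ t>0.$$ Moreover, for all $S>0$ and $\epsilon>0$ there is $\delta=\delta(S,\epsilon)>0$, depending only on $S$ and $\epsilon$, such that for every such graph, all $x,y\in X$ and all $t>0$ with $\rho_S(x,y)/t<\delta$, $$p_t(x,y)\le\frac{1}{\sqrt{m(x)m(y)}}\exp\left(-\frac{\rho_S(x,y)^2}{(2+\epsilon)t}\right).$$ -/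

import Mathlib

open MeasureTheory
open scoped ENNReal

universe u

noncomputable section

/-- A weighted graph `b` over a discrete measure space `(X, m)`: a strictly positive vertex
weight `m` and a symmetric edge weight `b ≥ 0` vanishing on the diagonal such that
`∑ y, b x y < ∞` for every vertex `x`. -/
structure WeightedGraph (X : Type u) where
  m : X → ℝ
  b : X → X → ℝ
  m_pos : ∀ x, 0 < m x
  b_nonneg : ∀ x y, 0 ≤ b x y
  b_symm : ∀ x y, b x y = b y x
  b_self : ∀ x, b x x = 0
  b_summable : ∀ x, Summable (b x)

namespace WeightedGraph

section Combinatorics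

variable {X : Type u} (G : WeightedGraph X)

/-- Adjacency `x ∼ y`. -/
def Adj (x y : X) : Prop := 0 < G.b x y

/-- Every vertex has finitely many neighbours. -/
def LocallyFinite : Prop := ∀ x, {y | G.Adj x y}.Finite

/-- Any two vertices are joined by a finite path of neighbours. -/
def Connected : Prop := ∀ x y, Relation.ReflTransGen G.Adj x y

/-- The formal Laplacian `Δ f (x) = m(x)⁻¹ ∑ y, b(x,y) (f(x) - f(y))`. -/
def formalLaplacian (f : X → ℂ) (x : X) : ℂ :=
  (1 / (G.m x : ℂ)) * ∑' y, (G.b x y : ℂ) * (f x - f y)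

/-- A pseudo-metric `ρ` is intrinsic if `∑ y, b(x,y) ρ(x,y)² ≤ m(x)` for all `x`. -/
def IsIntrinsic (ρ : PseudoMetric X ℝ) : Prop :=
  ∀ x, Summable (fun y => G.b x y * ρ x y ^ 2) ∧ ∑' y, G.b x y * ρ x y ^ 2 ≤ G.m x

/-- The jump size `sup {ρ(x,y) : b(x,y) > 0}` is at most `S`. -/
def JumpSizeLE (ρ : PseudoMetric X ℝ) (S : ℝ) : Prop := ∀ x y, G.Adj x y → ρ x y ≤ S

/-- The values `ρ(x,y)` of all intrinsic metrics `ρ` with jump size at most `S`. -/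
def intrinsicValues (S : ℝ) (x y : X) : Set ℝ :=
  {r | ∃ ρ : PseudoMetric X ℝ, G.IsIntrinsic ρ ∧ G.JumpSizeLE ρ S ∧ ρ x y = r}

/-- `ρ_S(x,y)`, the supremum of `ρ(x,y)` over all intrinsic metrics `ρ` with jump size at most
`S`. On a connected graph the set is nonempty and bounded above (see below). -/
def rhoS (S : ℝ) (x y : X) : ℝ := sSup (G.intrinsicValues S x y)

theorem intrinsicValues_nonempty {S : ℝ} (hS : 0 < S) (x y : X) :
    (G.intrinsicValues S x y).Nonempty :=
  ⟨0, ⊥, fun z => by simpa using (G.m_pos z).le,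
    fun _ _ _ => by simpa using hS.le, by simp⟩

theorem intrinsicValues_bddAbove (hG : G.Connected) (S : ℝ) (x y : X) :
    BddAbove (G.intrinsicValues S x y) := by
  suffices h : ∃ C : ℝ, ∀ ρ : PseudoMetric X ℝ, G.JumpSizeLE ρ S → ρ x y ≤ C by
    obtain ⟨C, hC⟩ := h
    refine ⟨C, ?_⟩
    rintro r ⟨ρ, -, hρ, rfl⟩
    exact hC ρ hρ
  induction hG x y with
  | refl => exact ⟨0, fun ρ _ => by simp⟩
  | @tail z w _ hzw ih =>
    obtain ⟨C, hC⟩ := ih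
    exact ⟨C + S, fun ρ hρ => (ρ.triangle x z w).trans (add_le_add (hC ρ hρ) (hρ z w hzw))⟩

end Combinatorics

section HeatKernel

variable {X : Type u} [MeasurableSpace X] [DiscreteMeasurableSpace X] [Countable X]
variable (G : WeightedGraph X)

/-- The measure `m` on the vertex set. -/
def vertexMeasure : Measure X :=
  Measure.sum fun x => ENNReal.ofReal (G.m x) • Measure.dirac x

/-- The measure on `X × X` with mass `b(x,y) / 2` at `(x,y)`. -/
def edgeMeasure : Measure (X × X) :=
  Measure.sum fun p : X × X => ENNReal.ofReal (G.b p.1 p.2 / 2) • Measure.dirac p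

/-- The complex Hilbert space `ℓ²(X, m)`. -/
abbrev L2 : Type u := Lp ℂ 2 G.vertexMeasure

/-- The space of square integrable functions on pairs of vertices. The gradient
`(x,y) ↦ f x - f y` of `f` has squared norm `½ ∑ b(x,y) |f x - f y|² = 𝓔(f)` there. -/
abbrev EdgeL2 : Type u := Lp ℂ 2 G.edgeMeasure

/-- The function equal to one at `x` and zero elsewhere. -/
def deltaFun (x : X) : X → ℂ := Set.indicator {x} 1

theorem vertexMeasure_singleton (x : X) :
    G.vertexMeasure {x} = ENNReal.ofReal (G.m x) := by
  rw [vertexMeasure, Measure.sum_apply _ (MeasurableSet.of_discrete), tsum_eq_single x]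
  · simp
  · intro y hy
    simp [hy]

theorem edgeMeasure_fst_ne_top (x : X) : G.edgeMeasure (Prod.fst ⁻¹' {x}) ≠ ∞ := by
  have hinj : Function.Injective (Prod.mk x : X → X × X) := fun _ _ h => (Prod.mk.inj h).2
  rw [edgeMeasure, Measure.sum_apply _ (MeasurableSet.of_discrete), ← hinj.tsum_eq]
  · have : ∀ y, (ENNReal.ofReal (G.b x y / 2) • Measure.dirac (x, y)) (Prod.fst ⁻¹' {x})
        = ENNReal.ofReal (G.b x y / 2) := fun y => by simp
    simp only [this]
    exact ((G.b_summable x).div_const 2).tsum_ofReal_ne_top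
  · rintro ⟨y, z⟩ h
    by_cases hy : y = x
    · exact ⟨z, by simp [hy]⟩
    · simp [hy] at h

theorem edgeMeasure_snd_ne_top (x : X) : G.edgeMeasure (Prod.snd ⁻¹' {x}) ≠ ∞ := by
  have hinj : Function.Injective (fun y : X => (y, x)) := fun _ _ h => (Prod.mk.inj h).1
  rw [edgeMeasure, Measure.sum_apply _ (MeasurableSet.of_discrete), ← hinj.tsum_eq]
  · have : ∀ y, (ENNReal.ofReal (G.b y x / 2) • Measure.dirac (y, x)) (Prod.snd ⁻¹' {x})
        = ENNReal.ofReal (G.b x y / 2) := fun y => by simp [G.b_symm]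
    simp only [this]
    exact ((G.b_summable x).div_const 2).tsum_ofReal_ne_top
  · rintro ⟨y, z⟩ h
    by_cases hz : z = x
    · exact ⟨y, by simp [hz]⟩
    · simp [hz] at h

theorem memLp_deltaFun (x : X) : MemLp (deltaFun x) 2 G.vertexMeasure :=
  memLp_indicator_const 2 MeasurableSet.of_discrete 1
    (Or.inr (by rw [vertexMeasure_singleton]; exact ENNReal.ofReal_ne_top))

theorem memLp_gradient_deltaFun (x : X) :
    MemLp (fun p : X × X => deltaFun x p.1 - deltaFun x p.2) 2 G.edgeMeasure :=
  (memLp_indicator_const 2 (s := Prod.fst ⁻¹' {x}) MeasurableSet.of_discrete (1 : ℂ)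
      (Or.inr (G.edgeMeasure_fst_ne_top x))).sub
    (memLp_indicator_const 2 (s := Prod.snd ⁻¹' {x}) MeasurableSet.of_discrete (1 : ℂ)
      (Or.inr (G.edgeMeasure_snd_ne_top x)))

/-- `δ_x` as an element of `ℓ²(X, m)`. -/
def delta (x : X) : G.L2 := (G.memLp_deltaFun x).toLp _

/-- The gradient of `δ_x`. -/
def gradDelta (x : X) : G.EdgeL2 := (G.memLp_gradient_deltaFun x).toLp _

/-- The closure of `{(f, ∇f) : f ∈ C_c(X)}` in `ℓ²(X, m) ⊕ EdgeL2`; here `C_c(X)` is the span of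
the functions `δ_x`, and the norm of `(f, ∇f)` is the form norm `(‖f‖² + 𝓔(f))^(1/2)`. -/
def formGraph : Submodule ℂ (WithLp 2 (G.L2 × G.EdgeL2)) :=
  (Submodule.span ℂ
    (Set.range fun x => WithLp.toLp 2 (G.delta x, G.gradDelta x))).topologicalClosure

instance : CompleteSpace G.formGraph :=
  (Submodule.isClosed_topologicalClosure _).completeSpace_coe

/-- The domain of the Dirichlet form: the closure of `C_c(X)` in the form norm. -/
def formDomain : Submodule ℂ G.L2 := G.formGraph.map (WithLp.fstL 2 ℂ G.L2 G.EdgeL2).toLinearMap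

/-- `Δ u = g` for the Laplacian `Δ ≥ 0` in `ℓ²(X, m)` associated with the Dirichlet form, that is,
the Friedrichs extension of the formal Laplacian on `C_c(X)`: `u` belongs to the form domain and
the square integrable function `g` is the formal Laplacian of `u`. -/
def IsLaplacian (u g : G.L2) : Prop :=
  u ∈ G.formDomain ∧ ∀ x, g x = G.formalLaplacian u x

/-- The resolvent `(1 + Δ)⁻¹` on `ℓ²(X, m)`: it maps `f` to the first component of the orthogonal
projection of `(f, 0)` onto the closed subspace `{(u, ∇u) : u ∈ D(𝓔)}`, that is, to the unique
`u ∈ D(𝓔)` with `𝓔(u, v) + ⟨u, v⟩ = ⟨f, v⟩` for all `v ∈ D(𝓔)`.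
See `resolvent_eq_iff`. -/
def resolvent : G.L2 →L[ℂ] G.L2 :=
  WithLp.fstL 2 ℂ G.L2 G.EdgeL2 ∘L G.formGraph.starProjection ∘L
    ((WithLp.prodContinuousLinearEquiv 2 ℂ G.L2 G.EdgeL2).symm : _ →L[ℂ] _) ∘L
    ContinuousLinearMap.inl ℂ G.L2 G.EdgeL2

/-- The function `s ↦ exp (-t (s⁻¹ - 1))` on `(0, 1]`, extended by zero to `s ≤ 0`. It is
continuous for `t > 0`, and it maps `(1 + r)⁻¹` to `exp (-t r)` for `r ≥ 0`. -/
def heatFun (t s : ℝ) : ℝ := if s ≤ 0 then 0 else Real.exp (-t * (s⁻¹ - 1))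

/-- The operator `e^{-tA}` for `t > 0` and a self-adjoint operator `A ≥ 0` on a complex Hilbert
space, obtained from `R = (1 + A)⁻¹` by the continuous functional calculus. -/
def semigroupOfResolvent {E : Type u} [NormedAddCommGroup E] [InnerProductSpace ℂ E]
    [CompleteSpace E] (R : E →L[ℂ] E) (t : ℝ) : E →L[ℂ] E := cfc (heatFun t) R

/-- The heat semigroup `e^{-tΔ}` for `t > 0`. -/
def heatSemigroup (t : ℝ) : G.L2 →L[ℂ] G.L2 := semigroupOfResolvent G.resolvent t

/-- The heat kernel `p_t(x,y) = ⟨δ_x, e^{-tΔ} δ_y⟩ / (m(x) m(y))` for `t > 0`. -/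
def heatKernel (t : ℝ) (x y : X) : ℝ :=
  (inner ℂ (G.delta x) (G.heatSemigroup t (G.delta y))).re / (G.m x * G.m y)

theorem continuous_heatFun {t : ℝ} (ht : 0 < t) : Continuous (heatFun t) := by
  have h : heatFun t = fun s => Real.exp t * expNegInvGlue (s / t) := by
    funext s
    rcases le_or_gt s 0 with hs | hs
    · simp [heatFun, hs, expNegInvGlue.zero_of_nonpos (div_nonpos_of_nonpos_of_nonneg hs ht.le)]
    · rw [heatFun, if_neg hs.not_ge, expNegInvGlue, if_neg (div_pos hs ht).not_ge, ← Real.exp_add]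
      congr 1
      field_simp
      ring
  rw [h]
  exact continuous_const.mul ((expNegInvGlue.contDiff (n := 0)).continuous.comp (by fun_prop))

theorem resolvent_isSelfAdjoint : IsSelfAdjoint G.resolvent := by
  rw [ContinuousLinearMap.isSelfAdjoint_iff_isSymmetric]
  intro f g
  have h := G.formGraph.inner_starProjection_left_eq_right (WithLp.toLp 2 (f, 0))
    (WithLp.toLp 2 (g, 0))
  simpa [WithLp.prod_inner_apply, resolvent] using h

theorem inner_delta (x : X) (f : G.L2) : inner ℂ (G.delta x) f = G.m x * f x := by
  have hfin : G.vertexMeasure {x} ≠ ∞ := by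
    rw [vertexMeasure_singleton]; exact ENNReal.ofReal_ne_top
  have h : G.delta x = indicatorConstLp 2 MeasurableSet.of_discrete hfin (1 : ℂ) := rfl
  rw [h, L2.inner_indicatorConstLp_one, integral_singleton, Measure.real,
    vertexMeasure_singleton, ENNReal.toReal_ofReal (G.m_pos x).le]
  simp

theorem edgeMeasure_singleton (p : X × X) :
    G.edgeMeasure {p} = ENNReal.ofReal (G.b p.1 p.2 / 2) := by
  rw [edgeMeasure, Measure.sum_apply _ (MeasurableSet.of_discrete), tsum_eq_single p]
  · simp
  · intro y hy
    simp [hy]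

theorem ae_vertexMeasure {P : X → Prop} (h : ∀ᵐ x ∂G.vertexMeasure, P x) (x : X) : P x := by
  by_contra hx
  have h0 : G.vertexMeasure {x} = 0 :=
    measure_mono_null (by simpa using hx) (ae_iff.mp h)
  rw [vertexMeasure_singleton, ENNReal.ofReal_eq_zero] at h0
  exact absurd (G.m_pos x) h0.not_gt

/-- Elements of the graph closure are pairs `(u, ∇u)`. -/
theorem snd_of_mem_formGraph {w : WithLp 2 (G.L2 × G.EdgeL2)} (hw : w ∈ G.formGraph)
    (p : X × X) : G.b p.1 p.2 * w.snd p = G.b p.1 p.2 * (w.fst p.1 - w.fst p.2) := by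
  rcases (G.b_nonneg p.1 p.2).eq_or_lt with hp | hp
  · simp [← hp]
  have hfin : G.edgeMeasure {p} ≠ ∞ := by
    rw [edgeMeasure_singleton]; exact ENNReal.ofReal_ne_top
  let e : G.EdgeL2 := indicatorConstLp 2 MeasurableSet.of_discrete hfin (1 : ℂ)
  have he : ∀ F : G.EdgeL2, inner ℂ e F = (G.b p.1 p.2 / 2 : ℝ) * F p := by
    intro F
    rw [L2.inner_indicatorConstLp_one, integral_singleton, Measure.real, edgeMeasure_singleton,
      ENNReal.toReal_ofReal (by positivity)]
    simp
  have hcont : ∀ w ∈ G.formGraph, inner ℂ e w.snd = (G.b p.1 p.2 / 2 : ℝ) *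
      ((G.m p.1 : ℂ)⁻¹ * inner ℂ (G.delta p.1) w.fst
        - (G.m p.2 : ℂ)⁻¹ * inner ℂ (G.delta p.2) w.fst) := by
    let L₁ : WithLp 2 (G.L2 × G.EdgeL2) →L[ℂ] ℂ := innerSL ℂ e ∘L WithLp.sndL 2 ℂ G.L2 G.EdgeL2
    let L₂ : WithLp 2 (G.L2 × G.EdgeL2) →L[ℂ] ℂ := ((G.b p.1 p.2 / 2 : ℝ) : ℂ) •
      ((G.m p.1 : ℂ)⁻¹ • innerSL ℂ (G.delta p.1) - (G.m p.2 : ℂ)⁻¹ • innerSL ℂ (G.delta p.2)) ∘L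
        WithLp.fstL 2 ℂ G.L2 G.EdgeL2
    suffices h : G.formGraph ≤ (L₁ - L₂).ker by
      intro w hw
      have := h hw
      simpa [L₁, L₂, sub_eq_zero] using this
    refine Submodule.topologicalClosure_minimal _ ?_ (L₁ - L₂).isClosed_ker
    rw [Submodule.span_le]
    rintro _ ⟨x, rfl⟩
    have h1 : ∀ z, (G.delta x : X → ℂ) z = deltaFun x z :=
      G.ae_vertexMeasure (G.memLp_deltaFun x).coeFn_toLp
    have h2 : (G.gradDelta x : X × X → ℂ) p = deltaFun x p.1 - deltaFun x p.2 := by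
      by_contra hx
      have h0 : G.edgeMeasure {p} = 0 := measure_mono_null (by simpa [gradDelta] using hx)
        (ae_iff.mp (G.memLp_gradient_deltaFun x).coeFn_toLp)
      rw [edgeMeasure_singleton, ENNReal.ofReal_eq_zero] at h0
      linarith
    have hm : ∀ z, (G.m z : ℂ) ≠ 0 := fun z => by exact_mod_cast (G.m_pos z).ne'
    have h3 := hm p.1
    have h4 := hm p.2
    simp [L₁, L₂, he, inner_delta, h1, h2, h3, h4]
  have h := hcont w hw
  rw [he, inner_delta, inner_delta] at h
  have h3 : (G.m p.1 : ℂ) ≠ 0 := by exact_mod_cast (G.m_pos p.1).ne'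
  have h4 : (G.m p.2 : ℂ) ≠ 0 := by exact_mod_cast (G.m_pos p.2).ne'
  rw [inv_mul_cancel_left₀ h3, inv_mul_cancel_left₀ h4] at h
  push_cast at h
  linear_combination 2 * h

theorem setIntegral_edgeMeasure (F : G.EdgeL2) (s : Set (X × X)) (hs : G.edgeMeasure s ≠ ∞) :
    ∫ p in s, F p ∂G.edgeMeasure
      = ∑' p, s.indicator (fun p => ((G.b p.1 p.2 / 2 : ℝ) : ℂ) * F p) p := by
  have hint : IntegrableOn (F : X × X → ℂ) s G.edgeMeasure :=
    integrableOn_Lp_of_measure_ne_top F (by norm_num) hs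
  rw [← integrable_indicator_iff MeasurableSet.of_discrete] at hint
  rw [← integral_indicator MeasurableSet.of_discrete]
  refine (integral_sum_measure hint).trans ?_
  refine tsum_congr fun p => ?_
  rw [integral_smul_measure, integral_dirac, ENNReal.toReal_ofReal
    (div_nonneg (G.b_nonneg _ _) (by norm_num))]
  by_cases hp : p ∈ s <;> simp [hp]

/-- Green's formula. -/
theorem inner_gradDelta {w : WithLp 2 (G.L2 × G.EdgeL2)} (hw : w ∈ G.formGraph) (x : X) :
    inner ℂ (G.gradDelta x) w.snd = G.m x * G.formalLaplacian w.fst x := by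
  have hsub : G.gradDelta x
      = indicatorConstLp 2 MeasurableSet.of_discrete (G.edgeMeasure_fst_ne_top x) (1 : ℂ)
        - indicatorConstLp 2 MeasurableSet.of_discrete (G.edgeMeasure_snd_ne_top x) (1 : ℂ) := rfl
  have hm : (G.m x : ℂ) ≠ 0 := by exact_mod_cast (G.m_pos x).ne'
  have hF : ∀ p : X × X, ((G.b p.1 p.2 / 2 : ℝ) : ℂ) * w.snd p
      = ((G.b p.1 p.2 / 2 : ℝ) : ℂ) * (w.fst p.1 - w.fst p.2) := fun p => by
    have := G.snd_of_mem_formGraph hw p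
    push_cast
    linear_combination this / 2
  have hinj1 : Function.Injective (Prod.mk x : X → X × X) := fun _ _ h => (Prod.mk.inj h).2
  have hinj2 : Function.Injective (fun y : X => (y, x)) := fun _ _ h => (Prod.mk.inj h).1
  rw [hsub, inner_sub_left, L2.inner_indicatorConstLp_one, L2.inner_indicatorConstLp_one,
    setIntegral_edgeMeasure _ _ _ (G.edgeMeasure_fst_ne_top x),
    setIntegral_edgeMeasure _ _ _ (G.edgeMeasure_snd_ne_top x), ← hinj1.tsum_eq, ← hinj2.tsum_eq]
  · simp only [hF]
    have e1 : ∀ y, (Prod.fst ⁻¹' {x} : Set (X × X)).indicator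
        (fun p => ((G.b p.1 p.2 / 2 : ℝ) : ℂ) * (w.fst p.1 - w.fst p.2)) (x, y)
        = (1 / 2) * ((G.b x y : ℂ) * (w.fst x - w.fst y)) := fun y => by
      simp; ring
    have e2 : ∀ y, (Prod.snd ⁻¹' {x} : Set (X × X)).indicator
        (fun p => ((G.b p.1 p.2 / 2 : ℝ) : ℂ) * (w.fst p.1 - w.fst p.2)) (y, x)
        = (-1 / 2) * ((G.b x y : ℂ) * (w.fst x - w.fst y)) := fun y => by
      simp [G.b_symm y x]; ring
    simp only [e1, e2, tsum_mul_left, formalLaplacian]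
    field_simp
    ring
  · rintro ⟨y, z⟩ h
    by_cases hz : z = x
    · exact ⟨y, by simp [hz]⟩
    · simp [hz] at h
  · rintro ⟨y, z⟩ h
    by_cases hy : y = x
    · exact ⟨z, by simp [hy]⟩
    · simp [hy] at h

/-- `resolvent` is indeed the inverse of `1 + Δ`: one has `(1 + Δ)⁻¹ f = u` if and only if
`u` is in the domain of `Δ` and `Δ u = f - u`. -/
theorem resolvent_eq_iff (f u : G.L2) : G.resolvent f = u ↔ G.IsLaplacian u (f - u) := by
  have hm : ∀ z, (G.m z : ℂ) ≠ 0 := fun z => by exact_mod_cast (G.m_pos z).ne'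
  have key : ∀ w ∈ G.formGraph, (∀ x, (f - w.fst : G.L2) x = G.formalLaplacian w.fst x) ↔
      WithLp.toLp 2 (f, 0) - w ∈ G.formGraphᗮ := by
    intro w hw
    have hcl : G.formGraphᗮ = (Submodule.span ℂ
        (Set.range fun x => WithLp.toLp 2 (G.delta x, G.gradDelta x)))ᗮ :=
      Submodule.orthogonal_closure _
    rw [hcl, ← Submodule.span_singleton_le_iff_mem,
      ← Submodule.isOrtho_iff_le, Submodule.isOrtho_comm, Submodule.isOrtho_iff_le,
      Submodule.span_le, Set.range_subset_iff]
    refine forall_congr' fun x => ?_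
    rw [SetLike.mem_coe, Submodule.mem_orthogonal_singleton_iff_inner_left,
      WithLp.prod_inner_apply]
    simp only [WithLp.ofLp_sub, Prod.fst_sub, Prod.snd_sub, zero_sub,
      inner_neg_right]
    have h1 := G.inner_gradDelta hw x
    have h2 := G.inner_delta x (f - w.fst)
    have h1' : inner ℂ (G.gradDelta x) (WithLp.ofLp w).2 = _ := h1
    have h2' : inner ℂ (G.delta x) (f - (WithLp.ofLp w).1) = _ := h2
    rw [h1', h2', ← sub_eq_add_neg, ← mul_sub, mul_eq_zero, or_iff_right (hm x), sub_eq_zero]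
  constructor
  · rintro rfl
    have hw : G.formGraph.starProjection (WithLp.toLp 2 (f, 0)) ∈ G.formGraph :=
      Submodule.starProjection_apply_mem _ _
    exact ⟨⟨_, hw, rfl⟩, (key _ hw).mpr (Submodule.sub_starProjection_mem_orthogonal _)⟩
  · rintro ⟨⟨w, hw, rfl⟩, h⟩
    have := Submodule.eq_starProjection_of_mem_orthogonal hw ((key w hw).mp h)
    exact congrArg WithLp.fst this

end HeatKernel

end WeightedGraph

/-- The function `ζ(x) = x arsinh x + 1 - √(x² + 1)`. -/
def zeta (x : ℝ) : ℝ := x * Real.arsinh x + 1 - Real.sqrt (x ^ 2 + 1)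

end

/-!
The proof is Davies' exponential perturbation method, carried out for resolvents instead of the heat
flow. Fix an intrinsic metric `ρ` of jump size at most `S`, a number `κ` and the weight
`ω = κ ρ(y,·)`. For a finitely supported function `u` the symmetry of `b` gives
`Re 𝓔(u, e^{2ω} u) ≥ -c ‖e^ω u‖²`, where `c = (cosh (κ S) - 1) / S²`: the weights enter only through
`∑ y, b(x,y) (cosh (ω(x) - ω(y)) - 1)`, and `cosh (κ ρ) - 1 ≤ (ρ / S)² (cosh (κ S) - 1)` for
`ρ ≤ S`, so that being intrinsic bounds this sum by `c m(x)` (`WeightedGraph.sum_mul_cosh_le`).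
Consequently `u = (1 + s Δ)⁻¹ f` satisfies `(1 - s c) ‖e^ω u‖ ≤ ‖e^ω f‖` as long as `s c < 1`.

As `e^{2ω} u` need not belong to the form domain, the resolvent bound is first shown for the Galerkin
approximations, the solutions of `(1 + s Δ) u = f` on a finite set `K` with zero values outside `K`.
There it is an inequality between finite sums (`weighted_sum_sq_le`). The solutions are orthogonal
projections to an increasing family of subspaces and converge to `(1 + s Δ)⁻¹ f` as `K` exhausts the
graph (`WeightedGraph.weighted_starProjection_scaledGraph_le`).

The heat semigroup is the limit of `(1 + (t / n) Δ)⁻ⁿ` along `n = 2 ^ k`, which follows from Dini's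
theorem for the functions of `(1 + Δ)⁻¹` representing these operators
(`exists_tendsto_semigroupOfResolvent`). Iterating the resolvent bound from `δ_y` therefore gives
`p_t(x,y) ≤ (m(x) m(y))^(-1/2) exp (t c - κ ρ(x,y))`. For fixed `κ` one may take the supremum over
`ρ` (`WeightedGraph.heatKernel_le_rhoS`). The optimal choice `κ S = arsinh (ρ_S(x,y) S / t)` is the
first claim, and `κ = ρ_S(x,y) / t` together with `cosh v - 1 ≤ (v² / 2) (1 + v² / 2)` for small `v`
is the second.
-/

/-! ### Resolvent functions and the exponential -/

/-- The function `σ ↦ σ / (σ + s (1 - σ))`, which maps `(1 + r)⁻¹` to `(1 + s r)⁻¹` for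
`r ≥ 0`: it turns the resolvent `(1 + A)⁻¹` into `(1 + s A)⁻¹`. -/
noncomputable def resolventFun (s σ : ℝ) : ℝ := σ / (σ + s * (1 - σ))

theorem resolventFun_denom_pos {s σ : ℝ} (hs : 0 < s) (hσ : σ ∈ Set.Icc (0 : ℝ) 1) :
    0 < σ + s * (1 - σ) := by
  rcases hσ.2.eq_or_lt with rfl | h
  · simp
  · have := mul_pos hs (sub_pos.2 h)
    linarith [hσ.1]

theorem continuousOn_resolventFun {s : ℝ} (hs : 0 < s) :
    ContinuousOn (resolventFun s) (Set.Icc 0 1) := by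
  unfold resolventFun
  exact ContinuousOn.div (by fun_prop) (by fun_prop) fun σ hσ => (resolventFun_denom_pos hs hσ).ne'

theorem resolventFun_eq_inv {s σ : ℝ} (hσ : σ ≠ 0) :
    resolventFun s σ = (1 + s * (σ⁻¹ - 1))⁻¹ := by
  have : σ + s * (1 - σ) = σ * (1 + s * (σ⁻¹ - 1)) := by field_simp
  rw [resolventFun, this, div_mul_eq_div_div, div_self hσ, one_div]

open Filter Topology in
/-- Along `n = 2 ^ k` the functions `(1 + (t / n) r)⁻ⁿ` of `σ = (1 + r)⁻¹` decrease to `exp (-t r)`,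
by `(1 + x / 2)² ≥ 1 + x`, so Dini's theorem applies; at `σ = 0` all of them vanish. -/
theorem tendstoUniformlyOn_resolventFun_pow {t : ℝ} (ht : 0 < t) :
    TendstoUniformlyOn (fun (k : ℕ) σ => resolventFun (t / 2 ^ k) σ ^ 2 ^ k)
      (WeightedGraph.heatFun t) atTop (Set.Icc 0 1) := by
  refine Antitone.tendstoUniformlyOn_of_forall_tendsto isCompact_Icc
    (fun k => (continuousOn_resolventFun (by positivity)).pow _) ?_
    (WeightedGraph.continuous_heatFun ht).continuousOn ?_
  · intro σ hσ
    rcases hσ.1.eq_or_lt with rfl | h0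
    · intro k l _
      simp [resolventFun]
    · refine antitone_nat_of_succ_le fun k => ?_
      have hl : 0 ≤ σ⁻¹ - 1 := sub_nonneg.2 ((one_le_inv₀ h0).2 hσ.2)
      simp only [resolventFun_eq_inv h0.ne']
      rw [pow_succ' (2 : ℕ) k, pow_succ (2 : ℝ) k, pow_mul, ← div_div]
      have hx : 0 ≤ t / 2 ^ k * (σ⁻¹ - 1) := by positivity
      refine pow_le_pow_left₀ (by positivity) ?_ _
      rw [inv_pow]
      refine inv_anti₀ (by positivity) ?_
      nlinarith [sq_nonneg (t / 2 ^ k * (σ⁻¹ - 1))]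
  · intro σ hσ
    rcases hσ.1.eq_or_lt with rfl | h0
    · simp [resolventFun, WeightedGraph.heatFun]
    · simp only [resolventFun_eq_inv h0.ne', WeightedGraph.heatFun, if_neg h0.not_ge]
      have h := ((Real.tendsto_one_add_div_pow_exp (t * (σ⁻¹ - 1))).inv₀ (Real.exp_ne_zero _)).comp
        (tendsto_pow_atTop_atTop_of_one_lt (one_lt_two : (1 : ℕ) < 2))
      rw [← Real.exp_neg, ← neg_mul] at h
      refine h.congr fun k => ?_
      simp [inv_pow, div_mul_eq_mul_div]

/-! ### The weighted estimate on a finite set -/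

theorem cosh_mul_sub_one_le {θ u : ℝ} (h0 : 0 ≤ θ) (h1 : θ ≤ 1) :
    Real.cosh (θ * u) - 1 ≤ θ ^ 2 * (Real.cosh u - 1) := by
  have hu := (hasSum_nat_add_iff' 1).2 (Real.hasSum_cosh u)
  have hv := (hasSum_nat_add_iff' 1).2 (Real.hasSum_cosh (θ * u))
  simp only [Finset.range_one, Finset.sum_singleton, mul_zero, pow_zero, Nat.factorial_zero,
    Nat.cast_one, div_one] at hu hv
  -- termwise comparison of the power series without their constant terms
  refine hasSum_le (fun n => ?_) hv (hu.mul_left (θ ^ 2))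
  rw [mul_pow, ← mul_div_assoc]
  have h2 : θ ^ (2 * (n + 1)) ≤ θ ^ 2 := pow_le_pow_of_le_one h0 h1 (by omega)
  have h3 : 0 ≤ u ^ (2 * (n + 1)) := by rw [pow_mul]; positivity
  gcongr

/-- The resolvent bound `(1 - s c) ‖e^ω a‖ ≤ ‖e^ω f‖`, squared, for a solution `a` of
`(1 + s Δ) a = f` on `K` with zero values outside `K`. Here `d x` is the full vertex degree, which
includes the edges leaving `K`. -/
theorem weighted_sum_sq_le {ι : Type*} (K : Finset ι) {m d ω : ι → ℝ} {b : ι → ι → ℝ}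
    {a f : ι → ℂ} {s c : ℝ} (hm : ∀ x, 0 < m x) (hd0 : ∀ x, 0 ≤ d x) (hb : ∀ x y, 0 ≤ b x y)
    (hsymm : ∀ x y, b x y = b y x) (hs : 0 ≤ s) (hsc : s * c < 1)
    (hd : ∀ x ∈ K, ∑ y ∈ K, b x y * Real.cosh (ω x - ω y) ≤ d x + c * m x)
    (heq : ∀ x ∈ K, (m x : ℂ) * (f x - a x) = s * (d x * a x - ∑ y ∈ K, b x y * a y)) :
    (1 - s * c) ^ 2 * ∑ x ∈ K, m x * (Real.exp (ω x) * ‖a x‖) ^ 2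
      ≤ ∑ x ∈ K, m x * (Real.exp (ω x) * ‖f x‖) ^ 2 := by
  set α : ι → ℝ := fun x => Real.exp (ω x) * ‖a x‖ with hα
  set φ : ι → ℝ := fun x => Real.exp (ω x) * ‖f x‖ with hφ
  -- the equation, in absolute values and multiplied by `exp (ω x)`
  have hpt : ∀ x ∈ K, (m x + s * d x) * α x
      ≤ m x * φ x + s * ∑ y ∈ K, b x y * Real.exp (ω x - ω y) * α y := by
    intro x hx
    have h1 : ((m x + s * d x : ℝ) : ℂ) * a x = m x * f x + s * ∑ y ∈ K, b x y * a y := by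
      push_cast
      linear_combination -heq x hx
    have h2 : (m x + s * d x) * ‖a x‖ ≤ m x * ‖f x‖ + s * ∑ y ∈ K, b x y * ‖a y‖ := by
      have h3 := congrArg norm h1
      rw [norm_mul, Complex.norm_of_nonneg (add_nonneg (hm x).le (mul_nonneg hs (hd0 x)))] at h3
      rw [h3]
      refine (norm_add_le _ _).trans ?_
      rw [norm_mul, norm_mul, Complex.norm_of_nonneg (hm x).le, Complex.norm_of_nonneg hs]
      gcongr
      refine (norm_sum_le _ _).trans (Finset.sum_le_sum fun y _ => ?_)
      rw [norm_mul, Complex.norm_of_nonneg (hb x y)]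
    have h4 := mul_le_mul_of_nonneg_left h2 (Real.exp_pos (ω x)).le
    calc (m x + s * d x) * α x = Real.exp (ω x) * ((m x + s * d x) * ‖a x‖) := by
          simp only [hα]; ring
      _ ≤ _ := h4
      _ = _ := by
          rw [mul_add, mul_left_comm _ s, Finset.mul_sum]
          congr 1
          · simp only [hφ]; ring
          · congr 1
            refine Finset.sum_congr rfl fun y _ => ?_
            simp only [hα, Real.exp_sub]
            field_simp
  -- by symmetry of `b` the double sum only sees the even part `cosh` of the exponential
  have hsym : ∑ x ∈ K, ∑ y ∈ K, b x y * Real.exp (ω x - ω y) * α y * α x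
      ≤ ∑ x ∈ K, ∑ y ∈ K, b x y * Real.cosh (ω x - ω y) * α x ^ 2 := by
    have e1 : ∑ x ∈ K, ∑ y ∈ K, b x y * Real.exp (ω x - ω y) * α y * α x
        = ∑ x ∈ K, ∑ y ∈ K, b x y * Real.exp (-(ω x - ω y)) * α y * α x := by
      rw [Finset.sum_comm]
      refine Finset.sum_congr rfl fun x _ => Finset.sum_congr rfl fun y _ => ?_
      rw [hsymm y x, neg_sub]; ring
    have e2 : ∑ x ∈ K, ∑ y ∈ K, b x y * Real.cosh (ω x - ω y) * α x ^ 2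
        = ∑ x ∈ K, ∑ y ∈ K, b x y * Real.cosh (ω x - ω y) * α y ^ 2 := by
      rw [Finset.sum_comm]
      refine Finset.sum_congr rfl fun x _ => Finset.sum_congr rfl fun y _ => ?_
      rw [hsymm y x, ← Real.cosh_neg, neg_sub]
    suffices h : (∑ x ∈ K, ∑ y ∈ K, b x y * Real.exp (ω x - ω y) * α y * α x
        + ∑ x ∈ K, ∑ y ∈ K, b x y * Real.exp (-(ω x - ω y)) * α y * α x)
        ≤ ∑ x ∈ K, ∑ y ∈ K, b x y * Real.cosh (ω x - ω y) * α x ^ 2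
        + ∑ x ∈ K, ∑ y ∈ K, b x y * Real.cosh (ω x - ω y) * α y ^ 2 by
      rw [← e1, ← e2] at h
      linarith
    simp only [← Finset.sum_add_distrib]
    refine Finset.sum_le_sum fun x _ => Finset.sum_le_sum fun y _ => ?_
    have h5 : 0 ≤ b x y * Real.cosh (ω x - ω y) * (α x - α y) ^ 2 :=
      mul_nonneg (mul_nonneg (hb x y) (Real.cosh_pos _).le) (sq_nonneg _)
    have h6 : Real.exp (ω x - ω y) + Real.exp (-(ω x - ω y)) = 2 * Real.cosh (ω x - ω y) := by
      rw [Real.cosh_eq]; ring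
    linear_combination h5 + b x y * α y * α x * h6
  have hdouble : ∑ x ∈ K, ∑ y ∈ K, b x y * Real.cosh (ω x - ω y) * α x ^ 2
      ≤ ∑ x ∈ K, (d x + c * m x) * α x ^ 2 := by
    refine Finset.sum_le_sum fun x hx => ?_
    rw [← Finset.sum_mul]
    exact mul_le_mul_of_nonneg_right (hd x hx) (sq_nonneg _)
  have hsum : ∑ x ∈ K, (m x + s * d x) * α x ^ 2 ≤ ∑ x ∈ K, m x * φ x * α x
      + s * ∑ x ∈ K, ∑ y ∈ K, b x y * Real.exp (ω x - ω y) * α y * α x := by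
    rw [Finset.mul_sum, ← Finset.sum_add_distrib]
    refine Finset.sum_le_sum fun x hx => ?_
    have h7 := mul_le_mul_of_nonneg_right (hpt x hx)
      (mul_nonneg (Real.exp_pos (ω x)).le (norm_nonneg (a x)) : 0 ≤ α x)
    rw [← Finset.sum_mul]
    linear_combination h7
  have hmain : (1 - s * c) * ∑ x ∈ K, m x * α x ^ 2 ≤ ∑ x ∈ K, m x * φ x * α x := by
    have h8 := mul_le_mul_of_nonneg_left (hsym.trans hdouble) hs
    have e3 : ∑ x ∈ K, (m x + s * d x) * α x ^ 2 - s * ∑ x ∈ K, (d x + c * m x) * α x ^ 2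
        = (1 - s * c) * ∑ x ∈ K, m x * α x ^ 2 := by
      simp only [Finset.mul_sum, ← Finset.sum_sub_distrib]
      exact Finset.sum_congr rfl fun x _ => by ring
    linarith
  -- Cauchy-Schwarz on the right-hand side, in the form `2 m φ α ≤ m φ² / q + q m α²`
  have hq : 0 < 1 - s * c := by linarith
  have hcs : 2 * ((1 - s * c) * ∑ x ∈ K, m x * φ x * α x)
      ≤ ∑ x ∈ K, m x * φ x ^ 2 + (1 - s * c) ^ 2 * ∑ x ∈ K, m x * α x ^ 2 := by
    simp only [Finset.mul_sum, ← Finset.sum_add_distrib]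
    refine Finset.sum_le_sum fun x _ => ?_
    have := mul_nonneg (hm x).le (sq_nonneg (φ x - (1 - s * c) * α x))
    linear_combination this
  have h9 := mul_le_mul_of_nonneg_left hmain hq.le
  linear_combination hcs + 2 * h9

/-! ### The exponential formula for semigroups -/

section FunctionalCalculus

variable {E : Type u} [NormedAddCommGroup E] [InnerProductSpace ℂ E] [CompleteSpace E]

theorem spectrum_subset_Icc {R : E →L[ℂ] E} (hR : IsSelfAdjoint R)
    (h0 : ∀ f, 0 ≤ (inner ℂ f (R f)).re) (h1 : ∀ f, (inner ℂ f (R f)).re ≤ (inner ℂ f f).re) :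
    spectrum ℝ R ⊆ Set.Icc 0 1 := by
  have hnn : 0 ≤ R := by
    rw [ContinuousLinearMap.nonneg_iff_isPositive, ContinuousLinearMap.isPositive_def']
    refine ⟨hR, fun f => ?_⟩
    rw [ContinuousLinearMap.reApplyInnerSelf_apply, inner_re_symm]
    exact h0 f
  have hle : 0 ≤ 1 - R := by
    rw [ContinuousLinearMap.nonneg_iff_isPositive, ContinuousLinearMap.isPositive_def']
    refine ⟨(IsSelfAdjoint.one _).sub hR, fun f => ?_⟩
    rw [ContinuousLinearMap.reApplyInnerSelf_apply, inner_re_symm]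
    simpa [inner_sub_right] using h1 f
  intro σ hσ
  refine ⟨spectrum_nonneg_of_nonneg hnn hσ, ?_⟩
  have h2 : 1 - σ ∈ spectrum ℝ (1 - R) := by
    have := spectrum.singleton_sub_eq R (1 : ℝ)
    rw [map_one] at this
    rw [← this]
    exact Set.sub_mem_sub rfl hσ
  linarith [spectrum_nonneg_of_nonneg hle h2]

open Filter Topology in
/-- The exponential formula `e^{-tA} = lim (1 + (t / n) A)⁻ⁿ` along `n = 2 ^ k`, for
`R = (1 + A)⁻¹`. The operator `T k = (1 + (t / 2 ^ k) A)⁻¹` is characterised by the resolvent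
identity `R (s⁻¹ (1 - T k) + T k) = T k`, `s = t / 2 ^ k`. -/
theorem exists_tendsto_semigroupOfResolvent {R : E →L[ℂ] E} (hR : IsSelfAdjoint R)
    (h0 : ∀ f, 0 ≤ (inner ℂ f (R f)).re) (h1 : ∀ f, (inner ℂ f (R f)).re ≤ (inner ℂ f f).re)
    {t : ℝ} (ht : 0 < t) :
    ∃ T : ℕ → E → E,
      (∀ k f, R (((t / 2 ^ k : ℝ) : ℂ)⁻¹ • (f - T k f) + T k f) = T k f) ∧
      ∀ f, Tendsto (fun k => (T k)^[2 ^ k] f) atTop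
        (𝓝 (WeightedGraph.semigroupOfResolvent R t f)) := by
  have hsp := spectrum_subset_Icc hR h0 h1
  have hcont : ∀ k : ℕ, ContinuousOn (resolventFun (t / 2 ^ k)) (spectrum ℝ R) := fun k =>
    (continuousOn_resolventFun (by positivity)).mono hsp
  refine ⟨fun k => ⇑(cfc (resolventFun (t / 2 ^ k)) R : E →L[ℂ] E), fun k f => ?_, fun f => ?_⟩
  · set s := t / 2 ^ k with hs
    have hs0 : 0 < s := by positivity
    have hc := hcont k
    rw [← hs] at hc
    set T := cfc (resolventFun s) R with hT
    have hop : R * (s⁻¹ • (1 - T) + T) = T := by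
      have h1 : cfc (fun σ => σ * (s⁻¹ • (1 - resolventFun s σ) + resolventFun s σ)) R
          = R * (s⁻¹ • (1 - T) + T) := by
        rw [cfc_mul (fun σ => σ) _ R (by fun_prop) (by fun_prop), cfc_id' ℝ R,
          cfc_add R _ _ (by fun_prop) (by fun_prop),
          cfc_smul _ _ R (by fun_prop), cfc_sub _ _ R (by fun_prop) (by fun_prop),
          cfc_const_one ℝ R]
      rw [← h1, hT]
      refine cfc_congr fun σ hσ => ?_
      have hd := (resolventFun_denom_pos hs0 (hsp hσ)).ne'
      simp only [resolventFun, smul_eq_mul]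
      field_simp
      ring
    have h2 := congrArg (fun A : E →L[ℂ] E => A f) hop
    rw [← Complex.ofReal_inv, Complex.coe_smul]
    exact h2
  · have hlim : Tendsto (fun k : ℕ => cfc (resolventFun (t / 2 ^ k)) R ^ 2 ^ k) atTop
        (𝓝 (cfc (WeightedGraph.heatFun t) R)) := by
      refine (tendsto_cfc_fun ((tendstoUniformlyOn_resolventFun_pow ht).mono hsp)
        (Eventually.of_forall fun k => (hcont k).pow _)).congr fun k => ?_
      exact cfc_pow _ _ _ (hcont k)
    have h3 := ((ContinuousLinearMap.apply ℂ E f).continuous.tendsto _).comp hlim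
    refine h3.congr fun k => ?_
    simp

end FunctionalCalculus

/-! ### Finite-dimensional approximation of the resolvent -/

namespace WeightedGraph

variable {X : Type u} [MeasurableSpace X] [DiscreteMeasurableSpace X] [Countable X]
variable (G : WeightedGraph X)

theorem coe_delta (x z : X) : (G.delta x : X → ℂ) z = deltaFun x z :=
  G.ae_vertexMeasure (G.memLp_deltaFun x).coeFn_toLp z

/-- The matrix of the Dirichlet form: vertex degrees on the diagonal, `-b` off it. -/
theorem inner_gradDelta_gradDelta [DecidableEq X] (x y : X) :
    inner ℂ (G.gradDelta x) (G.gradDelta y)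
      = (((if x = y then ∑' z, G.b x z else 0) - G.b x y : ℝ) : ℂ) := by
  have hw : WithLp.toLp 2 (G.delta y, G.gradDelta y) ∈ G.formGraph :=
    Submodule.le_topologicalClosure _ (Submodule.subset_span ⟨y, rfl⟩)
  have hm : (G.m x : ℂ) ≠ 0 := by exact_mod_cast (G.m_pos x).ne'
  have h := G.inner_gradDelta hw x
  change _ = (G.m x : ℂ) * G.formalLaplacian (G.delta y) x at h
  rw [formalLaplacian, ← mul_assoc, mul_one_div_cancel hm, one_mul] at h
  refine h.trans ?_
  simp only [coe_delta, deltaFun, Set.indicator_apply, Set.mem_singleton_iff, Pi.one_apply]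
  by_cases hxy : x = y
  · subst hxy
    rw [if_pos rfl, if_pos rfl, G.b_self, sub_zero, Complex.ofReal_tsum]
    refine tsum_congr fun z => ?_
    by_cases hz : z = x
    · simp [hz, G.b_self]
    · simp [hz]
  · rw [if_neg hxy, if_neg hxy, tsum_eq_single y]
    · simp
    · intro z hz
      simp [hz]

/-- The pair `(δ_x, r ∇δ_x)`. For `r = √s` the norm on the span of these pairs is the form norm
`(‖f‖² + s 𝓔(f))^(1/2)` of `1 + s Δ`. -/
noncomputable def scaledPair (r : ℝ) (x : X) : WithLp 2 (G.L2 × G.EdgeL2) :=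
  WithLp.toLp 2 (G.delta x, (r : ℂ) • G.gradDelta x)

/-- The finite-dimensional space of pairs `(f, r ∇f)` with `f` supported in the finite set `K`. -/
noncomputable def scaledSpan (r : ℝ) (K : Finset X) : Submodule ℂ (WithLp 2 (G.L2 × G.EdgeL2)) :=
  Submodule.span ℂ (G.scaledPair r '' K)

instance (r : ℝ) (K : Finset X) : FiniteDimensional ℂ (G.scaledSpan r K) :=
  FiniteDimensional.span_of_finite ℂ (K.finite_toSet.image _)

/-- The closure of `{(f, r ∇f) : f ∈ C_c(X)}`. -/
noncomputable def scaledGraph (r : ℝ) : Submodule ℂ (WithLp 2 (G.L2 × G.EdgeL2)) :=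
  (⨆ K : Finset X, G.scaledSpan r K).topologicalClosure

instance (r : ℝ) : CompleteSpace (G.scaledGraph r) :=
  (Submodule.isClosed_topologicalClosure _).completeSpace_coe

theorem scaledSpan_mono (r : ℝ) : Monotone (G.scaledSpan r) := fun _ _ h =>
  Submodule.span_mono (Set.image_mono (Finset.coe_subset.2 h))

theorem iSup_scaledSpan (r : ℝ) :
    ⨆ K : Finset X, G.scaledSpan r K = Submodule.span ℂ (Set.range (G.scaledPair r)) := by
  refine le_antisymm (iSup_le fun K => Submodule.span_mono (Set.image_subset_range _ _)) ?_
  rw [Submodule.span_le]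
  rintro _ ⟨x, rfl⟩
  exact Submodule.mem_iSup_of_mem {x} (Submodule.subset_span ⟨x, by simp, rfl⟩)

theorem inner_scaledPair (r : ℝ) (x : X) (w : WithLp 2 (G.L2 × G.EdgeL2)) :
    inner ℂ (G.scaledPair r x) w = G.m x * w.fst x + r * inner ℂ (G.gradDelta x) w.snd := by
  rw [WithLp.prod_inner_apply, ← G.inner_delta]
  simp only [scaledPair, inner_smul_left, Complex.conj_ofReal]
  rfl

/-- The projection `(a, r ∇a)` of `(f, 0)` to the pairs supported in `K` solves the equation
`(1 + r² Δ) a = f` on `K`. -/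
theorem starProjection_scaledSpan_eq (r : ℝ) (K : Finset X) (f : G.L2) {x : X} (hx : x ∈ K) :
    let a : X → ℂ := ((G.scaledSpan r K).starProjection (WithLp.toLp 2 (f, 0))).fst
    (G.m x : ℂ) * (f x - a x)
      = (r ^ 2 : ℝ) * ((∑' z, G.b x z : ℝ) * a x - ∑ y ∈ K, G.b x y * a y) := by
  classical
  intro a
  set P := (G.scaledSpan r K).starProjection (WithLp.toLp 2 (f, 0)) with hP
  have hPm : P ∈ G.scaledSpan r K := Submodule.starProjection_apply_mem _ _
  obtain ⟨α, hα⟩ := (Submodule.mem_span_image_finset_iff_exists_fun' ℂ).1 hPm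
  have hpt : ∀ z ∈ K, a z = α z := by
    intro z hz
    have hm : (G.m z : ℂ) ≠ 0 := by exact_mod_cast (G.m_pos z).ne'
    refine mul_left_cancel₀ hm ?_
    have h1 : P.fst = ∑ y ∈ K, α y • G.delta y := by
      rw [← hα]
      have := map_sum (WithLp.fstL 2 ℂ G.L2 G.EdgeL2) (fun y => α y • G.scaledPair r y) K
      simp only [map_smul] at this
      exact this
    have h2 : (G.m z : ℂ) * a z = inner ℂ (G.delta z) P.fst := (G.inner_delta z _).symm
    rw [h2, h1, inner_sum]
    simp only [inner_smul_right, inner_delta, coe_delta, deltaFun, Set.indicator_apply,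
      Set.mem_singleton_iff, Pi.one_apply]
    rw [Finset.sum_eq_single z]
    · simp [mul_comm]
    · intro y _ hy
      simp [hy.symm]
    · exact fun h => absurd hz h
  have hsnd : inner ℂ (G.gradDelta x) P.snd
      = r * ((∑' z, G.b x z : ℝ) * a x - ∑ y ∈ K, G.b x y * a y) := by
    have h1 : P.snd = ∑ y ∈ K, α y • (r : ℂ) • G.gradDelta y := by
      rw [← hα]
      have := map_sum (WithLp.sndL 2 ℂ G.L2 G.EdgeL2) (fun y => α y • G.scaledPair r y) K
      simp only [map_smul] at this
      exact this
    rw [h1, inner_sum]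
    simp only [inner_smul_right, inner_gradDelta_gradDelta]
    have h2 : (∑ y ∈ K, α y * ((r : ℂ) *
        (((if x = y then ∑' z, G.b x z else 0) - G.b x y : ℝ) : ℂ)))
        = r * (∑ y ∈ K, (if x = y then (∑' z, G.b x z : ℝ) * a y else 0)
            - ∑ y ∈ K, G.b x y * a y) := by
      rw [← Finset.sum_sub_distrib, Finset.mul_sum]
      refine Finset.sum_congr rfl fun y hy => ?_
      rw [hpt y hy]
      split_ifs <;> push_cast <;> ring
    rw [h2, Finset.sum_ite_eq, if_pos hx]
  have horth : inner ℂ (G.scaledPair r x) (WithLp.toLp 2 (f, 0) - P) = 0 :=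
    (Submodule.mem_orthogonal _ _).1 (Submodule.sub_starProjection_mem_orthogonal _) _
      (Submodule.subset_span ⟨x, hx, rfl⟩)
  rw [inner_sub_right, inner_scaledPair, inner_scaledPair, hsnd] at horth
  change (G.m x : ℂ) * f x + r * inner ℂ (G.gradDelta x) (0 : G.EdgeL2) - (G.m x * a x + _) = 0
    at horth
  rw [inner_zero_right] at horth
  rw [Complex.ofReal_pow]
  linear_combination horth

open Filter Topology in
theorem tendsto_starProjection_scaledSpan (r : ℝ) (f : G.L2) (x : X) :
    Tendsto (fun K : Finset X =>
        ((G.scaledSpan r K).starProjection (WithLp.toLp 2 (f, 0))).fst x) atTop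
      (𝓝 (((G.scaledGraph r).starProjection (WithLp.toLp 2 (f, 0))).fst x)) := by
  have h := Submodule.starProjection_tendsto_closure_iSup (G.scaledSpan r) (G.scaledSpan_mono r)
    (WithLp.toLp 2 (f, 0))
  have hm : (G.m x : ℂ) ≠ 0 := by exact_mod_cast (G.m_pos x).ne'
  have hev : ∀ w : WithLp 2 (G.L2 × G.EdgeL2),
      w.fst x = (G.m x : ℂ)⁻¹ * innerSL ℂ (G.delta x) (WithLp.fstL 2 ℂ G.L2 G.EdgeL2 w) := by
    intro w
    change _ = (G.m x : ℂ)⁻¹ * inner ℂ (G.delta x) w.fst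
    rw [inner_delta, inv_mul_cancel_left₀ hm]
  simp only [hev]
  exact tendsto_const_nhds.mul (((innerSL ℂ (G.delta x) ∘L
    WithLp.fstL 2 ℂ G.L2 G.EdgeL2).continuous.tendsto _).comp h)

open Filter Topology in
/-- The weighted bound for finite sets survives the exhaustion of the graph, so it holds for the
resolvent `(1 + r² Δ)⁻¹`. -/
theorem weighted_starProjection_scaledGraph_le {r c M : ℝ} {ω : X → ℝ} (hrc : r ^ 2 * c < 1)
    (hω : ∀ x (K : Finset X),
      ∑ y ∈ K, G.b x y * Real.cosh (ω x - ω y) ≤ ∑' y, G.b x y + c * G.m x)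
    {f : G.L2} (hf : ∀ K : Finset X, ∑ x ∈ K, G.m x * (Real.exp (ω x) * ‖f x‖) ^ 2 ≤ M)
    (K : Finset X) :
    (1 - r ^ 2 * c) ^ 2 * ∑ x ∈ K, G.m x * (Real.exp (ω x) *
      ‖((G.scaledGraph r).starProjection (WithLp.toLp 2 (f, 0))).fst x‖) ^ 2 ≤ M := by
  -- the estimate on `L ⊇ K` is restricted to `K` before `L` exhausts the graph
  have hlim := tendsto_finsetSum K fun x _ =>
    (((G.tendsto_starProjection_scaledSpan r f x).norm.const_mul
      (Real.exp (ω x))).pow 2).const_mul (G.m x)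
  refine le_of_tendsto (hlim.const_mul ((1 - r ^ 2 * c) ^ 2)) ?_
  filter_upwards [eventually_ge_atTop K] with L hL
  refine le_trans ?_ ((weighted_sum_sq_le L G.m_pos (fun x => tsum_nonneg (G.b_nonneg x))
    G.b_nonneg G.b_symm (sq_nonneg r) hrc (fun x _ => hω x L)
    (fun x hx => G.starProjection_scaledSpan_eq r L f hx)).trans (hf L))
  refine mul_le_mul_of_nonneg_left (Finset.sum_le_sum_of_subset_of_nonneg hL fun x _ _ => ?_)
    (sq_nonneg _)
  exact mul_nonneg (G.m_pos x).le (sq_nonneg _)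

/-- The equation `(1 + Δ)⁻¹ (r⁻² (f - u) + u) = u` says that `r² Δ u = f - u`, so
`u = (1 + r² Δ)⁻¹ f`; the projection of `(f, 0)` to the closure of the pairs `(v, r ∇v)` computes the
same function. -/
theorem starProjection_scaledGraph_fst {r : ℝ} (hr : r ≠ 0) {f u : G.L2}
    (hu : G.resolvent (((r ^ 2 : ℝ) : ℂ)⁻¹ • (f - u) + u) = u) :
    ((G.scaledGraph r).starProjection (WithLp.toLp 2 (f, 0))).fst = u := by
  set g : G.L2 := ((r ^ 2 : ℝ) : ℂ)⁻¹ • (f - u) + u with hg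
  set w := G.formGraph.starProjection (WithLp.toLp 2 (g, 0)) with hw
  have hwm : w ∈ G.formGraph := Submodule.starProjection_apply_mem _ _
  have hwu : w.fst = u := hu
  -- `D (u, p) = (u, r p)` maps the form graph into the scaled graph
  let D : WithLp 2 (G.L2 × G.EdgeL2) →L[ℂ] WithLp 2 (G.L2 × G.EdgeL2) :=
    ((WithLp.prodContinuousLinearEquiv 2 ℂ G.L2 G.EdgeL2).symm : _ →L[ℂ] _) ∘L
      ((WithLp.fstL 2 ℂ G.L2 G.EdgeL2).prod ((r : ℂ) • WithLp.sndL 2 ℂ G.L2 G.EdgeL2))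
  have hD : ∀ v, D v = WithLp.toLp 2 (v.fst, (r : ℂ) • v.snd) := fun v => rfl
  have hmem : D w ∈ G.scaledGraph r := by
    have hle : G.formGraph ≤ (G.scaledGraph r).comap D.toLinearMap := by
      refine Submodule.topologicalClosure_minimal _ ?_
        ((Submodule.isClosed_topologicalClosure _).preimage D.continuous)
      rw [Submodule.span_le]
      rintro _ ⟨x, rfl⟩
      refine Submodule.le_topologicalClosure _ ?_
      rw [iSup_scaledSpan]
      exact Submodule.subset_span ⟨x, rfl⟩
    exact hle hwm
  have horth : WithLp.toLp 2 (f, 0) - D w ∈ (G.scaledGraph r)ᗮ := by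
    rw [scaledGraph, Submodule.orthogonal_closure, iSup_scaledSpan,
      ← Submodule.span_singleton_le_iff_mem,
      ← Submodule.isOrtho_iff_le, Submodule.isOrtho_comm, Submodule.isOrtho_iff_le,
      Submodule.span_le, Set.range_subset_iff]
    intro x
    rw [SetLike.mem_coe, Submodule.mem_orthogonal_singleton_iff_inner_left]
    -- the variational characterisation of `(1 + Δ)⁻¹ g = u`, tested with `δ_x`
    have h1 : inner ℂ (G.delta x) (g - u) = inner ℂ (G.gradDelta x) w.snd := by
      have := (Submodule.mem_orthogonal _ _).1
        (Submodule.sub_starProjection_mem_orthogonal (K := G.formGraph) (WithLp.toLp 2 (g, 0))) _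
        (Submodule.le_topologicalClosure _ (Submodule.subset_span ⟨x, rfl⟩))
      rw [WithLp.prod_inner_apply] at this
      have h2 : inner ℂ (G.delta x) (g - w.fst) + inner ℂ (G.gradDelta x) (0 - w.snd) = 0 := this
      rw [hwu, zero_sub, inner_neg_right] at h2
      linear_combination h2
    have h3 : inner ℂ (G.delta x) (f - u) = r ^ 2 * inner ℂ (G.gradDelta x) w.snd := by
      rw [← h1, hg, add_sub_cancel_right, inner_smul_right]
      have : (r : ℂ) ≠ 0 := by exact_mod_cast hr
      push_cast
      field_simp
    rw [WithLp.prod_inner_apply]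
    change inner ℂ (G.delta x) (f - w.fst)
      + inner ℂ ((r : ℂ) • G.gradDelta x) (0 - (r : ℂ) • w.snd) = 0
    rw [hwu, h3, zero_sub, inner_neg_right, inner_smul_left, inner_smul_right, Complex.conj_ofReal]
    ring
  rw [Submodule.eq_starProjection_of_mem_orthogonal hmem horth, hD]
  exact hwu

/-! ### The weighted estimate for the heat semigroup -/

theorem inner_resolvent (f : G.L2) :
    inner ℂ f (G.resolvent f)
      = inner ℂ (WithLp.toLp 2 (f, 0)) (G.formGraph.starProjection (WithLp.toLp 2 (f, 0))) := by
  rw [WithLp.prod_inner_apply]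
  change _ = inner ℂ f (G.resolvent f) + inner ℂ (0 : G.EdgeL2) _
  rw [inner_zero_left, add_zero]

theorem re_inner_resolvent_nonneg (f : G.L2) : 0 ≤ (inner ℂ f (G.resolvent f)).re := by
  rw [inner_resolvent]
  have h := G.formGraph.re_inner_starProjection_nonneg (WithLp.toLp 2 (f, 0))
  rwa [Submodule.inner_starProjection_left_eq_right] at h

theorem re_inner_resolvent_le (f : G.L2) :
    (inner ℂ f (G.resolvent f)).re ≤ (inner ℂ f f).re := by
  have h := G.formGraphᗮ.re_inner_starProjection_nonneg (WithLp.toLp 2 (f, 0))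
  rw [Submodule.inner_starProjection_left_eq_right, Submodule.starProjection_orthogonal_val,
    inner_sub_right, ← inner_resolvent, WithLp.prod_inner_apply] at h
  change 0 ≤ (inner ℂ f f + inner ℂ (0 : G.EdgeL2) 0 - inner ℂ f (G.resolvent f)).re at h
  rw [inner_zero_left, add_zero, Complex.sub_re] at h
  linarith

open Filter Topology in
/-- Davies' method: an exponential weight `exp ω` whose form perturbation is at most `c` makes the
heat semigroup grow at most like `exp (t c)` in the weighted norm. -/
theorem weighted_heatSemigroup_delta_le {ω : X → ℝ} {c t : ℝ} (ht : 0 < t)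
    (hω : ∀ x (K : Finset X),
      ∑ y ∈ K, G.b x y * Real.cosh (ω x - ω y) ≤ ∑' y, G.b x y + c * G.m x) (x y : X) :
    Real.exp (-(t * c)) ^ 2 * (G.m x * (Real.exp (ω x) * ‖G.heatSemigroup t (G.delta y) x‖) ^ 2)
      ≤ G.m y * Real.exp (ω y) ^ 2 := by
  classical
  obtain ⟨T, hT, hlim⟩ := exists_tendsto_semigroupOfResolvent G.resolvent_isSelfAdjoint
    G.re_inner_resolvent_nonneg G.re_inner_resolvent_le ht
  set M := G.m y * Real.exp (ω y) ^ 2 with hM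
  have hstep : ∀ k : ℕ, t / 2 ^ k * c < 1 → ∀ j (K : Finset X),
      ∑ z ∈ K, G.m z * (Real.exp (ω z) * ‖((T k)^[j] (G.delta y) : G.L2) z‖) ^ 2
        ≤ M / ((1 - t / 2 ^ k * c) ^ 2) ^ j := by
    intro k hk j
    have hs : 0 < t / 2 ^ k := by positivity
    have hsq : √(t / 2 ^ k) ^ 2 = t / 2 ^ k := Real.sq_sqrt hs.le
    have hpos : 0 < (1 - t / 2 ^ k * c) ^ 2 := pow_pos (by linarith) 2
    induction j with
    | zero =>
      intro K
      simp only [Function.iterate_zero, id, pow_zero, div_one]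
      have h0 : ∀ z, G.m z * (Real.exp (ω z) * ‖(G.delta y : X → ℂ) z‖) ^ 2
          = if y = z then M else 0 := by
        intro z
        rw [coe_delta, deltaFun]
        by_cases hz : z = y
        · simp [hz, hM]
        · simp [hz, Ne.symm hz]
      simp only [h0, Finset.sum_ite_eq]
      split_ifs
      · exact le_rfl
      · exact mul_nonneg (G.m_pos y).le (sq_nonneg _)
    | succ j ih =>
      intro K
      rw [Function.iterate_succ_apply', pow_succ, ← div_div, le_div_iff₀ hpos, mul_comm]
      have hu := hT k ((T k)^[j] (G.delta y))
      rw [← hsq] at hu hk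
      rw [← G.starProjection_scaledGraph_fst (Real.sqrt_pos.2 hs).ne' hu]
      have := G.weighted_starProjection_scaledGraph_le hk hω ih K
      rwa [hsq] at this
  have hm : (G.m x : ℂ) ≠ 0 := by exact_mod_cast (G.m_pos x).ne'
  have hev : ∀ f : G.L2, f x = (G.m x : ℂ)⁻¹ * innerSL ℂ (G.delta x) f := by
    intro f
    change _ = (G.m x : ℂ)⁻¹ * inner ℂ (G.delta x) f
    rw [inner_delta, inv_mul_cancel_left₀ hm]
  have hpt : Tendsto (fun k => ((T k)^[2 ^ k] (G.delta y) : G.L2) x) atTop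
      (𝓝 (G.heatSemigroup t (G.delta y) x)) := by
    simp only [hev]
    exact tendsto_const_nhds.mul (((innerSL ℂ (G.delta x)).continuous.tendsto _).comp
      (hlim (G.delta y)))
  have hexp : Tendsto (fun k : ℕ => (1 - t / 2 ^ k * c) ^ 2 ^ k) atTop
      (𝓝 (Real.exp (-(t * c)))) := by
    refine ((Real.tendsto_one_add_div_pow_exp (-(t * c))).comp
      (tendsto_pow_atTop_atTop_of_one_lt (one_lt_two : (1 : ℕ) < 2))).congr fun k => ?_
    simp only [Function.comp_apply, Nat.cast_pow, Nat.cast_ofNat]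
    congr 1
    ring
  have hsmall : ∀ᶠ k : ℕ in atTop, t / 2 ^ k * c < 1 := by
    have h2 : Tendsto (fun k : ℕ => t / 2 ^ k * c) atTop (𝓝 (0 * c)) :=
      (tendsto_const_nhds.div_atTop
        (tendsto_pow_atTop_atTop_of_one_lt (one_lt_two : (1 : ℝ) < 2))).mul_const c
    rw [zero_mul] at h2
    exact h2.eventually_lt_const one_pos
  refine le_of_tendsto ((hexp.pow 2).mul
    (((hpt.norm.const_mul (Real.exp (ω x))).pow 2).const_mul (G.m x))) ?_
  filter_upwards [hsmall] with k hk
  have hpos : 0 < ((1 - t / 2 ^ k * c) ^ 2) ^ 2 ^ k := pow_pos (pow_pos (by linarith) 2) _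
  have h3 := hstep k hk (2 ^ k) {x}
  rw [Finset.sum_singleton, le_div_iff₀ hpos] at h3
  rw [pow_right_comm, mul_comm]
  exact h3

end WeightedGraph

/-! ### Intrinsic metrics and the heat kernel bounds -/

namespace WeightedGraph

section Metric

variable {X : Type u} (G : WeightedGraph X)

theorem rhoS_nonneg (S : ℝ) (x y : X) : 0 ≤ G.rhoS S x y :=
  Real.sSup_nonneg fun _ ⟨ρ, _, _, hr⟩ => hr ▸ ρ.nonneg x y

/-- The form perturbation caused by the weight `exp (κ ρ(z,·))` of an intrinsic metric `ρ` of jump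
size at most `S` is at most `(cosh (κ S) - 1) / S²`. -/
theorem sum_mul_cosh_le {ρ : PseudoMetric X ℝ} (hρ : G.IsIntrinsic ρ) {S : ℝ} (hS : 0 < S)
    (hJ : G.JumpSizeLE ρ S) (κ : ℝ) (z x : X) (K : Finset X) :
    ∑ y ∈ K, G.b x y * Real.cosh (κ * ρ z x - κ * ρ z y)
      ≤ ∑' y, G.b x y + (Real.cosh (κ * S) - 1) / S ^ 2 * G.m x := by
  set c := (Real.cosh (κ * S) - 1) / S ^ 2 with hc
  have hc0 : 0 ≤ c := div_nonneg (sub_nonneg.2 (Real.one_le_cosh _)) (sq_nonneg S)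
  have hterm : ∀ y, G.b x y * Real.cosh (κ * ρ z x - κ * ρ z y)
      ≤ G.b x y + c * (G.b x y * ρ x y ^ 2) := by
    intro y
    rcases (G.b_nonneg x y).eq_or_lt with h0 | hpos
    · simp [← h0]
    have hρS : ρ x y ≤ S := hJ x y hpos
    have hρ0 : 0 ≤ ρ x y := ρ.nonneg x y
    have h1 : |κ * ρ z x - κ * ρ z y| ≤ |κ * ρ x y| := by
      rw [← mul_sub, abs_mul, abs_mul, abs_of_nonneg hρ0]
      refine mul_le_mul_of_nonneg_left ?_ (abs_nonneg κ)
      have t1 := ρ.triangle z x y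
      have t2 := ρ.triangle z y x
      rw [ρ.symm y x] at t2
      exact abs_sub_le_iff.2 ⟨by linarith, by linarith⟩
    have h2 : Real.cosh (κ * ρ x y) - 1 ≤ c * ρ x y ^ 2 := by
      have h := cosh_mul_sub_one_le (u := κ * S) (div_nonneg hρ0 hS.le) ((div_le_one hS).2 hρS)
      have e1 : ρ x y / S * (κ * S) = κ * ρ x y := by field_simp
      rw [e1] at h
      refine h.trans (le_of_eq ?_)
      rw [hc]
      ring
    have h3 := mul_le_mul_of_nonneg_left (Real.cosh_le_cosh.2 h1) hpos.le
    have h4 := mul_le_mul_of_nonneg_left h2 hpos.le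
    linear_combination h3 + h4
  calc ∑ y ∈ K, G.b x y * Real.cosh (κ * ρ z x - κ * ρ z y)
      ≤ ∑ y ∈ K, (G.b x y + c * (G.b x y * ρ x y ^ 2)) := Finset.sum_le_sum fun y _ => hterm y
    _ = ∑ y ∈ K, G.b x y + c * ∑ y ∈ K, G.b x y * ρ x y ^ 2 := by
        rw [Finset.sum_add_distrib, Finset.mul_sum]
    _ ≤ _ := by
        refine add_le_add ((G.b_summable x).sum_le_tsum K fun y _ => G.b_nonneg x y)
          (mul_le_mul_of_nonneg_left (le_trans ?_ (hρ x).2) hc0)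
        exact (hρ x).1.sum_le_tsum K fun y _ => mul_nonneg (G.b_nonneg x y) (sq_nonneg _)

end Metric

variable {X : Type u} [MeasurableSpace X] [DiscreteMeasurableSpace X] [Countable X]
variable (G : WeightedGraph X)

theorem heatKernel_le_of_isIntrinsic {ρ : PseudoMetric X ℝ} (hρ : G.IsIntrinsic ρ) {S : ℝ}
    (hS : 0 < S) (hJ : G.JumpSizeLE ρ S) (κ : ℝ) {t : ℝ} (ht : 0 < t) (x y : X) :
    G.heatKernel t x y ≤ 1 / √(G.m x * G.m y) *
      Real.exp (t * ((Real.cosh (κ * S) - 1) / S ^ 2) - κ * ρ x y) := by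
  set c := (Real.cosh (κ * S) - 1) / S ^ 2 with hc
  have h := G.weighted_heatSemigroup_delta_le (ω := fun z => κ * ρ y z) ht
    (fun z K => G.sum_mul_cosh_le hρ hS hJ κ y z K) x y
  have hmx := G.m_pos x
  have hmy := G.m_pos y
  have hyy : ρ y y = 0 := ρ.refl y
  rw [← hc, hyy, mul_zero, Real.exp_zero, one_pow, mul_one, ρ.symm y x] at h
  -- `h` now bounds `exp (-t c + κ ρ(x,y)) |u(x)| m(x)^(1/2)` by `m(y)^(1/2)`, in squared form
  set N := ‖G.heatSemigroup t (G.delta y) x‖ with hN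
  have hN0 : 0 ≤ N := norm_nonneg _
  have hE : Real.exp (-(t * c)) * Real.exp (κ * ρ x y) * Real.exp (t * c - κ * ρ x y) = 1 := by
    rw [← Real.exp_add, ← Real.exp_add, ← Real.exp_zero]
    congr 1
    ring
  set A := Real.exp (t * c - κ * ρ x y) with hA
  have hA0 : 0 < A := Real.exp_pos _
  have hsq : G.m x * N ^ 2 ≤ G.m y * A ^ 2 := by
    have h1 := mul_le_mul_of_nonneg_right h (sq_nonneg A)
    refine le_trans (le_of_eq ?_) h1
    calc G.m x * N ^ 2
        = G.m x * N ^ 2 * (Real.exp (-(t * c)) * Real.exp (κ * ρ x y) * A) ^ 2 := by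
          rw [hE, one_pow, mul_one]
      _ = _ := by ring
  have hle : G.heatKernel t x y ≤ N / G.m y := by
    have h2 : G.heatKernel t x y = (G.heatSemigroup t (G.delta y) x).re / G.m y := by
      rw [heatKernel, inner_delta, Complex.re_ofReal_mul, mul_div_mul_left _ _ hmx.ne']
    rw [h2]
    exact div_le_div_of_nonneg_right (Complex.re_le_norm _) hmy.le
  refine hle.trans ?_
  have hr : 0 < √(G.m x * G.m y) := Real.sqrt_pos.2 (mul_pos hmx hmy)
  rw [one_div_mul_eq_div, div_le_div_iff₀ hmy hr]
  refine le_of_sq_le_sq ?_ (by positivity)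
  rw [mul_pow, mul_pow, Real.sq_sqrt (mul_pos hmx hmy).le]
  have := mul_le_mul_of_nonneg_right hsq hmy.le
  linear_combination this

/-- Since the bound depends on the intrinsic metric only through `ρ(x,y)`, the supremum over all
intrinsic metrics may be taken for each fixed `κ`. -/
theorem heatKernel_le_rhoS (hG : G.Connected) {S : ℝ} (hS : 0 < S) (κ : ℝ) {t : ℝ} (ht : 0 < t)
    (x y : X) :
    G.heatKernel t x y ≤ 1 / √(G.m x * G.m y) *
      Real.exp (t * ((Real.cosh (κ * S) - 1) / S ^ 2) - κ * G.rhoS S x y) := by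
  obtain ⟨u, -, hu, hmem⟩ := exists_seq_tendsto_sSup (G.intrinsicValues_nonempty hS x y)
    (G.intrinsicValues_bddAbove hG S x y)
  have hlim := (Real.continuous_exp.tendsto _).comp
    ((hu.const_mul κ).const_sub (t * ((Real.cosh (κ * S) - 1) / S ^ 2)))
  refine ge_of_tendsto' (hlim.const_mul (1 / √(G.m x * G.m y))) fun n => ?_
  obtain ⟨ρ, hρ, hJ, hn⟩ := hmem n
  have h := G.heatKernel_le_of_isIntrinsic hρ hS hJ κ ht x y
  rw [hn] at h
  exact h

end WeightedGraph

theorem mainTheorem2 :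
    (∀ (X : Type u) [MeasurableSpace X] [DiscreteMeasurableSpace X] [Countable X]
        (G : WeightedGraph X), G.LocallyFinite → G.Connected →
      ∀ S : ℝ, 0 < S → ∀ (x y : X) (t : ℝ), 0 < t →
        G.heatKernel t x y ≤ 1 / Real.sqrt (G.m x * G.m y) *
          Real.exp (-(t / S ^ 2) * zeta (G.rhoS S x y * S / t))) ∧
    (∀ S : ℝ, 0 < S → ∀ ε : ℝ, 0 < ε → ∃ δ : ℝ, 0 < δ ∧
      ∀ (X : Type u) [MeasurableSpace X] [DiscreteMeasurableSpace X] [Countable X]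
        (G : WeightedGraph X), G.LocallyFinite → G.Connected →
      ∀ (x y : X) (t : ℝ), 0 < t → G.rhoS S x y / t < δ →
        G.heatKernel t x y ≤ 1 / Real.sqrt (G.m x * G.m y) *
          Real.exp (-(G.rhoS S x y ^ 2 / ((2 + ε) * t)))) := by
  refine ⟨fun X _ _ _ G _ hG S hS x y t ht => ?_, fun S hS ε hε => ?_⟩
  · set r := G.rhoS S x y * S / t with hr
    -- the exponent is minimal where `t sinh (κ S) / S = ρ_S(x,y)`
    refine (G.heatKernel_le_rhoS hG hS (Real.arsinh r / S) ht x y).trans (le_of_eq ?_)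
    have hρr : G.rhoS S x y = r * t / S := by
      rw [hr]
      field_simp
    rw [div_mul_cancel₀ _ hS.ne', Real.cosh_arsinh, zeta, hρr, add_comm 1 (r ^ 2)]
    congr 2
    field_simp
    ring
  · -- the choice `κ = ρ_S(x,y) / t` is nearly optimal when it is small
    obtain ⟨η, hη0, hη1, hη⟩ : ∃ η : ℝ, 0 < η ∧ η ≤ 1 ∧ η ≤ ε / (2 + ε) :=
      ⟨min 1 (ε / (2 + ε)), by positivity, min_le_left _ _, min_le_right _ _⟩
    refine ⟨η / S, by positivity, fun X _ _ _ G _ hG x y t ht hδ => ?_⟩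
    have hρ := G.rhoS_nonneg S x y
    set ρ := G.rhoS S x y with hρdef
    set κ := ρ / t with hκ
    have hκ0 : 0 ≤ κ := by positivity
    refine (G.heatKernel_le_rhoS hG hS κ ht x y).trans ?_
    rw [← hρdef]
    refine mul_le_mul_of_nonneg_left (Real.exp_le_exp.2 ?_) (by positivity)
    have hv0 : 0 ≤ κ * S := by positivity
    have hvη : κ * S ≤ η := ((lt_div_iff₀ hS).1 hδ).le
    have hcosh : Real.cosh (κ * S) - 1 ≤ (κ * S) ^ 2 / 2 * (1 + η) := by
      -- `cosh v ≤ exp (v² / 2) ≤ 1 + v² / 2 + (v² / 2)²`, and `v ≤ η ≤ 1`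
      set v := κ * S
      have h1 : v ^ 2 / 2 ≤ η / 2 := by nlinarith
      have h2 := Real.abs_exp_sub_one_sub_id_le (x := v ^ 2 / 2)
        (by rw [abs_of_nonneg (by positivity)]; linarith)
      have h3 := (Real.cosh_le_exp_half_sq v).trans
        (sub_le_iff_le_add.1 (sub_le_iff_le_add.1 ((le_abs_self _).trans h2)))
      nlinarith [mul_le_mul_of_nonneg_left h1 (by positivity : 0 ≤ v ^ 2 / 2)]
    have hρt : ρ = κ * t := by rw [hκ]; field_simp
    have hc : (Real.cosh (κ * S) - 1) / S ^ 2 ≤ κ ^ 2 / 2 * (1 + η) := by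
      rw [div_le_iff₀ (by positivity)]
      linear_combination hcosh
    have hfrac : (1 + η) / 2 ≤ 1 - 1 / (2 + ε) := by
      have : ε / (2 + ε) = 1 - 2 * (1 / (2 + ε)) := by field_simp; ring
      linarith
    have e1 : ρ ^ 2 / ((2 + ε) * t) = κ ^ 2 * t * (1 / (2 + ε)) := by
      rw [hρt]
      field_simp
    rw [e1, hρt]
    have h5 := mul_le_mul_of_nonneg_left hc ht.le
    have h6 := mul_le_mul_of_nonneg_left hfrac (by positivity : 0 ≤ κ ^ 2 * t)
    linear_combination h5 + h6
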